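/- Let $(\mathcal F,+,\le)$ be a totally ordered abelian group and $\mathcal L$ an integral domain. Let $\mathcal R$ be the set of symbols $a^{[\ell]}$ with $a\in\mathcal F$ and $\ell\in\mathcal L$, with multiplication $a^{[k]}\cdot b^{[\ell]}=(a+b)^{[k\ell]}$ and with addition $a^{[k]}+b^{[\ell]}$ equal to $a^{[k]}$ if $a>b$, to $b^{[\ell]}$ if $a<b$, and to $a^{[k+\ell]}$ if $a=b$. Let $\overline{\mathcal R}=\mathcal R\cup\{-\infty\}$ be the commutative semiring obtained by adjoining an element $-\infty$ that is additively neutral and multiplicatively absorbing. Put $s(a^{[\ell]})=\ell$, $s(-\infty)=0$, and $\mathcal R^\times=\{\alpha\in\mathcal R: s(\alpha)\ne 0\}$. For an $n\times n$ matrix $M$ over a commutative semiring containing $\overline{\mathcal R}$, put $$\det M=\sum_{\sigma\ \mathrm{even}}\ \prod_{i=1}^n M_{i,\sigma(i)}+0^{[-1]}\sum_{\sigma\ \mathrm{odd}}\ \prod_{i=1}^n M_{i,\sigma(i)}.$$ For $A\in\overline{\mathcal R}^{\,n\times n}$ let $p_A(\lambda)=\det\bigl(\lambda I_n+0^{[-1]}A\bigr)\in\overline{\mathcal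 R}[\lambda]$ be its ELT characteristic polynomial. An element $x\in\overline{\mathcal R}$ is an eigenvalue of $A$ if there is a vector $v\in(\mathcal R^\times\cup\{-\infty\})^n$, $v\neq(-\infty,\dots,-\infty)$, with $Av=xv$. Then for every $A\in\overline{\mathcal R}^{\,n\times n}$ and every eigenvalue $x$ of $A$, $s(p_A(x))=0$. -/

import Mathlib

/-- Elements `a^[ℓ]` of the ELT algebra with tangible values in `F` and layers in `L`
(no element `-∞` yet). -/
@[ext]
structure ELT (F L : Type*) where
  /-- the tangible value `a` of `a^[ℓ]` -/
  tangible : F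
  /-- the layer `ℓ` of `a^[ℓ]` -/
  layer : L

namespace ELT

variable {F L : Type*}

/-- The larger tangible value wins; for equal tangible values the layers are added. -/
instance instAdd [LinearOrder F] [Add L] : Add (ELT F L) where
  add α β :=
    if β.tangible < α.tangible then α
    else if α.tangible < β.tangible then β
    else ⟨α.tangible, α.layer + β.layer⟩

/-- Tangible values are added and layers are multiplied. -/
instance instMul [Add F] [Mul L] : Mul (ELT F L) where
  mul α β := ⟨α.tangible + β.tangible, α.layer * β.layer⟩

instance instOne [Zero F] [One L] : One (ELT F L) where
  one := ⟨0, 1⟩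

theorem add_def [LinearOrder F] [Add L] (α β : ELT F L) :
    α + β = if β.tangible < α.tangible then α
      else if α.tangible < β.tangible then β
      else ⟨α.tangible, α.layer + β.layer⟩ := rfl

theorem mul_def [Add F] [Mul L] (α β : ELT F L) :
    α * β = ⟨α.tangible + β.tangible, α.layer * β.layer⟩ := rfl

theorem one_def [Zero F] [One L] : (1 : ELT F L) = ⟨0, 1⟩ := rfl

instance instAddCommSemigroup [LinearOrder F] [AddCommSemigroup L] :
    AddCommSemigroup (ELT F L) where
  add_assoc := by
    rintro ⟨a, k⟩ ⟨b, l⟩ ⟨c, m⟩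
    simp only [add_def]
    rcases lt_trichotomy a b with h | h | h <;> rcases lt_trichotomy b c with h' | h' | h' <;>
      rcases lt_trichotomy a c with h'' | h'' | h'' <;>
      first
        | (subst_vars; simp_all [add_assoc, not_lt_of_gt]; done)
        | (exfalso; order)
  add_comm := by
    rintro ⟨a, k⟩ ⟨b, l⟩
    simp only [add_def]
    rcases lt_trichotomy a b with h | h | h
    · simp [h, not_lt_of_gt h]
    · subst h; simp [add_comm]
    · simp [h, not_lt_of_gt h]

instance instCommMonoid [AddCommMonoid F] [CommMonoid L] : CommMonoid (ELT F L) where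
  mul_assoc α β γ := by simp [mul_def, add_assoc, mul_assoc]
  mul_comm α β := by simp [mul_def, add_comm, mul_comm]
  one_mul α := by simp [mul_def, one_def]
  mul_one α := by simp [mul_def, one_def]

instance instDistrib [AddCommGroup F] [LinearOrder F] [IsOrderedAddMonoid F] [CommRing L] :
    Distrib (ELT F L) where
  left_distrib := by
    rintro ⟨a, k⟩ ⟨b, l⟩ ⟨c, m⟩
    simp only [add_def, mul_def, add_lt_add_iff_left]
    split_ifs <;> simp [mul_add]
  right_distrib := by
    rintro ⟨a, k⟩ ⟨b, l⟩ ⟨c, m⟩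
    simp only [add_def, mul_def, add_lt_add_iff_right]
    split_ifs <;> simp [add_mul]

end ELT

/-- The ELT algebra with the element `-∞` adjoined.  Since `-∞` is additively neutral and
multiplicatively absorbing, it is the zero `0` of `WithZero`. -/
abbrev ELTBar (F L : Type*) := WithZero (ELT F L)

namespace ELTBar

variable {F L : Type*}

instance instCommSemiring [AddCommGroup F] [LinearOrder F] [IsOrderedAddMonoid F] [CommRing L] :
    CommSemiring (ELTBar F L) where
  left_distrib := left_distrib
  right_distrib := right_distrib
  mul_comm := mul_comm

/-- The element `a^[ℓ]`, as an element of the algebra with `-∞` adjoined. -/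
def mk (a : F) (ℓ : L) : ELTBar F L := ((⟨a, ℓ⟩ : ELT F L) : WithZero (ELT F L))

/-- The sorting map `s`: it sends `a^[ℓ]` to its layer `ℓ`, and `-∞` to `0`. -/
def s [Zero L] : ELTBar F L → L :=
  WithZero.recZeroCoe 0 ELT.layer

variable [AddCommGroup F] [LinearOrder F] [IsOrderedAddMonoid F] [CommRing L]

/-- The element `0^[-1]` of `ELTBar F L`, which plays the role of `-1`. -/
def negOne (F L : Type*) [AddCommGroup F] [LinearOrder F] [IsOrderedAddMonoid F] [CommRing L] :
    ELTBar F L :=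
  mk (0 : F) (-1 : L)

/-- Determinant over a commutative semiring `R` in which `e` plays the role of `-1`:
the sum over the even permutations, plus `e` times the sum over the odd ones. -/
def detWith {R : Type*} [CommSemiring R] (e : R) {n : ℕ} (A : Matrix (Fin n) (Fin n) R) : R :=
  ∑ σ : Equiv.Perm (Fin n) with Equiv.Perm.sign σ = 1, ∏ i, A i (σ i) +
    e * ∑ σ : Equiv.Perm (Fin n) with Equiv.Perm.sign σ = -1, ∏ i, A i (σ i)

/-- The ELT characteristic polynomial `p_A(X) = det (X I + 0^[-1] A)`, a polynomial over the
commutative semiring `ELTBar F L`. -/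
noncomputable def charpoly {n : ℕ} (A : Matrix (Fin n) (Fin n) (ELTBar F L)) :
    Polynomial (ELTBar F L) :=
  detWith (Polynomial.C (negOne F L))
    (Matrix.of fun i j =>
      Polynomial.X * (1 : Matrix (Fin n) (Fin n) (Polynomial (ELTBar F L))) i j +
        Polynomial.C (negOne F L) * Polynomial.C (A i j))

/-- `v` is an eigenvector of `A` with eigenvalue `x`: every entry of `v` is `-∞` or has nonzero
layer, `v` is not the vector `(-∞, …, -∞)`, and `A v = x v`. -/
def IsEigenvector {n : ℕ} (A : Matrix (Fin n) (Fin n) (ELTBar F L)) (x : ELTBar F L)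
    (v : Fin n → ELTBar F L) : Prop :=
  (∀ i, v i = 0 ∨ s (v i) ≠ 0) ∧ v ≠ 0 ∧ A.mulVec v = x • v

/-- `x` is an eigenvalue of `A` if it is the eigenvalue of some eigenvector. -/
def IsEigenvalue {n : ℕ} (A : Matrix (Fin n) (Fin n) (ELTBar F L)) (x : ELTBar F L) : Prop :=
  ∃ v : Fin n → ELTBar F L, IsEigenvector A x v

end ELTBar

/-! If `A v = x v`, then `B = xI + 0^[-1] A` satisfies `B v = (1 + 0^[-1]) x v`, and `1 + 0^[-1] =
0^[0]`, so all layers of `B v` vanish. It remains to transfer the classical fact "nontrivial kernel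
implies zero determinant" from the domain `L` (`s_detWith_eq_zero`). If every permutation product in
`B` is `-∞`, so is the determinant. Otherwise optimal assignment duality gives `u`, `w` with `val (B
i j) ≤ u i + w j`, with equality along an optimal permutation. Keeping only the layers of entries
that attain this bound gives a matrix over `L` whose determinant is the layer of `det B`
(`layerAt_detWith`). Truncating `v` in the same way at `max_j (w j + val (v j))` gives a nonzero
vector in the kernel of that matrix. -/

/-! ### Potentials and duality for optimal assignments -/

section Potentials

variable {ι F : Type*} [AddCommGroup F]

/-- Total weight of the steps of a path, given as the list of its vertices. -/
def pathWeight (b : ι → ι → WithBot F) : List ι → WithBot F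
  | [] => 0
  | [_] => 0
  | i :: j :: l => b i j + pathWeight b (j :: l)

theorem pathWeight_append (b : ι → ι → WithBot F) (l₁ l₂ : List ι) (i : ι) :
    pathWeight b (l₁ ++ i :: l₂) = pathWeight b (l₁ ++ [i]) + pathWeight b (i :: l₂) := by
  induction l₁ with
  | nil => simp [pathWeight]
  | cons k l ih =>
    cases l with
    | nil => simp [pathWeight]
    | cons m l =>
      simp only [List.cons_append, pathWeight] at ih ⊢
      rw [ih, add_assoc]

theorem sum_zipWith_eq_pathWeight (b : ι → ι → WithBot F) (i k : ι) (l : List ι) :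
    (List.zipWith b (i :: l) (l ++ [k])).sum = pathWeight b (i :: l ++ [k]) := by
  induction l generalizing i with
  | nil => simp [pathWeight]
  | cons j l ih =>
    have := ih j
    simp only [List.cons_append, List.zipWith_cons_cons, List.sum_cons, pathWeight] at this ⊢
    rw [this]

variable [LinearOrder F] [IsOrderedAddMonoid F] [Fintype ι] [DecidableEq ι]

/-- The weight of a simple cycle is the weight of the corresponding cyclic permutation. -/
theorem sum_formPerm (b : ι → ι → WithBot F) (hb : ∀ i, b i i = 0) (i : ι) (l : List ι)
    (hl : (i :: l).Nodup) :
    ∑ k, b k ((i :: l).formPerm k) = pathWeight b (i :: l ++ [i]) := by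
  have hsub : ∑ k, b k ((i :: l).formPerm k) =
      ∑ k ∈ (i :: l).toFinset, b k ((i :: l).formPerm k) := by
    refine (Finset.sum_subset (Finset.subset_univ _) fun k _ hk => ?_).symm
    rw [List.formPerm_apply_of_notMem (by simpa using hk), hb]
  rw [hsub, List.sum_toFinset _ hl, ← sum_zipWith_eq_pathWeight]
  congr 1
  apply List.ext_getElem
  · simp
  · intro m h₁ h₂
    have hm : m < (i :: l).length := by simpa using h₁
    simp only [List.getElem_map, List.getElem_zipWith]
    congr 1
    rw [List.formPerm_apply_getElem _ hl m hm]
    -- The last vertex is the one that wraps around to `i`.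
    rcases Nat.lt_or_ge m l.length with h | h
    · simp [List.getElem_append_left h, Nat.mod_eq_of_lt (Nat.succ_lt_succ h)]
    · have : m = l.length := by simp at hm; omega
      subst this
      simp

/-- A weighted digraph without cycles of positive weight has a potential. -/
theorem exists_potential (b : ι → ι → WithBot F) (hb : ∀ i, b i i = 0)
    (hperm : ∀ σ : Equiv.Perm ι, ∑ i, b i (σ i) ≤ 0) :
    ∃ w : ι → F, ∀ i j, b i j + w j ≤ w i := by
  let S : ι → Finset {l : List ι // l.Nodup} := fun i =>
    Finset.univ.filter fun l => l.1.head? = some i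
  -- The potential is the largest weight of a simple path starting at `i`; it is finite because the
  -- path `[i]` has weight `0`.
  let W : ι → WithBot F := fun i => (S i).sup fun l => pathWeight b l.1
  have hle : ∀ i l, (i :: l).Nodup → pathWeight b (i :: l) ≤ W i := fun i l hl =>
    Finset.le_sup (f := fun l : {l : List ι // l.Nodup} => pathWeight b l.1)
      (b := ⟨i :: l, hl⟩) (by simp [S])
  have hne : ∀ i, W i ≠ ⊥ := by
    intro i h
    have := hle i [] (by simp)
    rw [h, le_bot_iff] at this
    simp [pathWeight] at this
  have key : ∀ i j, b i j + W j ≤ W i := by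
    intro i j
    have hSj : (S j).Nonempty := ⟨⟨[j], by simp⟩, by simp [S]⟩
    obtain ⟨⟨l, hl⟩, hmem, heq⟩ :=
      Finset.exists_mem_eq_sup (S j) hSj fun l => pathWeight b l.1
    have hW : W j = pathWeight b l := heq
    rw [hW]
    obtain ⟨t, rfl⟩ : ∃ t, l = j :: t := by
      cases l with
      | nil => simp [S] at hmem
      | cons a t => exact ⟨t, by simp [S] at hmem; rw [hmem]⟩
    by_cases hi : i ∈ j :: t
    · by_cases hij : i = j
      · subst hij
        rw [hb, zero_add]
        exact hle _ _ hl
      · have hit : i ∈ t := by simpa [hij] using hi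
        -- Cut the optimal path from `j` where it meets `i`: the step from `i` to `j` and the first
        -- piece form a simple cycle of weight at most `0`, and the rest is a simple path from `i`.
        obtain ⟨l₁, l₂, rfl⟩ := List.append_of_mem hit
        have hcyc : (i :: j :: l₁).Nodup := by
          have : (j :: l₁ ++ i :: l₂).Nodup := hl
          rw [List.nodup_append] at this
          refine List.nodup_cons.2 ⟨fun h => this.2.2 i h i (by simp) rfl, this.1⟩
        have hpath : (i :: l₂).Nodup := by
          have : (j :: l₁ ++ i :: l₂).Nodup := hl
          rw [List.nodup_append] at this
          exact this.2.1
        have h₁ := pathWeight_append b (j :: l₁) l₂ i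
        have h₂ := sum_formPerm b hb i (j :: l₁) hcyc
        have h₃ := hperm (i :: j :: l₁).formPerm
        rw [h₂] at h₃
        simp only [List.cons_append, pathWeight] at h₁ h₃
        rw [h₁, ← add_assoc]
        calc _ ≤ 0 + pathWeight b (i :: l₂) := by gcongr
          _ ≤ W i := by rw [zero_add]; exact hle _ _ hpath
    · exact hle i (j :: t) (List.nodup_cons.2 ⟨hi, hl⟩)
  refine ⟨fun i => (W i).unbot (hne i), fun i j => ?_⟩
  simpa only [WithBot.coe_unbot] using key i j

/-- Linear programming duality for the optimal assignment problem. -/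
theorem exists_dual_of_optimal_assignment (b : ι → ι → WithBot F) (τ : Equiv.Perm ι)
    (hfin : ∀ i, b i (τ i) ≠ ⊥)
    (hmax : ∀ σ : Equiv.Perm ι, ∑ i, b i (σ i) ≤ ∑ i, b i (τ i)) :
    ∃ u w : ι → F, (∀ i j, b i j ≤ ((u i + w j : F) : WithBot F)) ∧
      ∀ i, b i (τ i) = ((u i + w (τ i) : F) : WithBot F) := by
  choose d hd using fun i => WithBot.ne_bot_iff_exists.1 (hfin i)
  have hcancel : ∀ i, ((-d i : F) : WithBot F) + d i = 0 := fun i => by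
    rw [← WithBot.coe_add, neg_add_cancel, WithBot.coe_zero]
  -- Subtracting the weights along `τ` and relabelling columns by `τ` turns `τ` into the identity
  -- with zero diagonal; optimality then says that no permutation has positive weight.
  obtain ⟨w, hw⟩ := exists_potential (fun i j => ((-d i : F) : WithBot F) + b i (τ j))
    (fun i => by rw [← hd, hcancel]) (fun σ => by
      rw [Finset.sum_add_distrib]
      calc _ ≤ ∑ i, ((-d i : F) : WithBot F) + ∑ i, b i (τ i) := by
            exact add_le_add le_rfl (hmax (σ.trans τ))
        _ = 0 := by
            rw [← Finset.sum_add_distrib]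
            exact Finset.sum_eq_zero fun i _ => by rw [← hd, hcancel])
  refine ⟨fun i => d i + w i, fun j => -w (τ.symm j), fun i j => ?_, fun i => ?_⟩
  · have h := hw i (τ.symm j)
    beta_reduce at h ⊢
    rw [Equiv.apply_symm_apply] at h
    cases hbij : b i j with
    | bot => exact bot_le
    | coe c =>
      rw [hbij] at h
      norm_cast at h ⊢
      rw [← sub_nonneg] at h ⊢
      convert h using 1
      abel
  · beta_reduce
    rw [Equiv.symm_apply_apply, ← hd]
    congr 1
    abel

end Potentials

namespace ELTBar

/-! ### Tangible values and leading layers -/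

section Value

variable {F L : Type*}

/-- The tangible value of an element, with `-∞` sent to `⊥`. -/
def val : ELTBar F L → WithBot F :=
  WithZero.recZeroCoe ⊥ fun α => (α.tangible : WithBot F)

@[simp] theorem val_zero : val (0 : ELTBar F L) = ⊥ := rfl

@[simp] theorem val_coe (α : ELT F L) : val (α : ELTBar F L) = α.tangible := rfl

@[simp] theorem s_zero [Zero L] : s (0 : ELTBar F L) = 0 := rfl

@[simp] theorem s_coe [Zero L] (α : ELT F L) : s (α : ELTBar F L) = α.layer := rfl

theorem val_eq_bot_iff {α : ELTBar F L} : val α = ⊥ ↔ α = 0 := by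
  cases α using WithZero.recZeroCoe <;> simp

section Order

variable [LinearOrder F] [CommRing L]

theorem val_add (α β : ELTBar F L) : val (α + β) = max (val α) (val β) := by
  cases α using WithZero.recZeroCoe with
  | zero => simp
  | coe α =>
    cases β using WithZero.recZeroCoe with
    | zero => simp
    | coe β =>
      rw [← WithZero.coe_add]
      simp only [val_coe, ELT.add_def, ← WithBot.coe_max, WithBot.coe_inj]
      split_ifs with h₁ h₂
      · exact (max_eq_left h₁.le).symm
      · exact (max_eq_right h₂.le).symm
      · exact (max_eq_left (not_lt.1 h₂)).symm

/-- The layer of an element at the tangible value `c`: it is `0` unless the element has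
tangible value `c`. -/
def layerAt (c : F) (α : ELTBar F L) : L :=
  if val α = c then s α else 0

theorem layerAt_of_val_eq {c : F} {α : ELTBar F L} (h : val α = c) : layerAt c α = s α :=
  if_pos h

theorem layerAt_of_s_eq_zero {c : F} {α : ELTBar F L} (h : s α = 0) : layerAt c α = 0 := by
  simp [layerAt, h]

theorem layerAt_zero (c : F) : layerAt c (0 : ELTBar F L) = 0 :=
  layerAt_of_s_eq_zero s_zero

end Order

variable [AddCommGroup F] [CommRing L]

theorem val_one : val (1 : ELTBar F L) = 0 := rfl

theorem s_one : s (1 : ELTBar F L) = 1 := rfl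

variable [LinearOrder F] [IsOrderedAddMonoid F]

theorem val_negOne : val (negOne F L) = 0 := rfl

theorem s_negOne : s (negOne F L) = -1 := rfl

theorem val_mul (α β : ELTBar F L) : val (α * β) = val α + val β := by
  cases α using WithZero.recZeroCoe with
  | zero => simp
  | coe α =>
    cases β using WithZero.recZeroCoe with
    | zero => simp
    | coe β => rw [← WithZero.coe_mul]; simp [ELT.mul_def]

theorem s_mul (α β : ELTBar F L) : s (α * β) = s α * s β := by
  cases α using WithZero.recZeroCoe with
  | zero => simp
  | coe α =>
    cases β using WithZero.recZeroCoe with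
    | zero => simp
    | coe β => rw [← WithZero.coe_mul]; simp [ELT.mul_def]

theorem s_one_add_negOne : s (1 + negOne F L) = 0 := by
  change s (((1 + ⟨0, -1⟩ : ELT F L) : ELTBar F L)) = 0
  simp [ELT.add_def, ELT.one_def]

theorem val_prod {ι : Type*} (S : Finset ι) (α : ι → ELTBar F L) :
    val (∏ i ∈ S, α i) = ∑ i ∈ S, val (α i) := by
  classical
  induction S using Finset.induction_on with
  | empty => exact val_one
  | insert i S hi ih => rw [Finset.prod_insert hi, Finset.sum_insert hi, val_mul, ih]

theorem val_sum_le {ι : Type*} {S : Finset ι} {α : ι → ELTBar F L} {c : WithBot F}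
    (h : ∀ i ∈ S, val (α i) ≤ c) : val (∑ i ∈ S, α i) ≤ c :=
  Finset.sum_induction _ (fun x => val x ≤ c)
    (fun _ _ hx hy => (val_add _ _).trans_le (max_le hx hy)) bot_le h

theorem val_le_val_sum {ι : Type*} {S : Finset ι} (α : ι → ELTBar F L) {i : ι} (hi : i ∈ S) :
    val (α i) ≤ val (∑ j ∈ S, α j) := by
  classical
  rw [← Finset.add_sum_erase S α hi, val_add]
  exact le_max_left _ _

/-- Below the common bound `c` nothing can dominate a term of value `c`, and smaller terms
contribute `0`; so `layerAt c` is additive there. -/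
theorem layerAt_add {c : F} {α β : ELTBar F L} (hα : val α ≤ c) (hβ : val β ≤ c) :
    layerAt c (α + β) = layerAt c α + layerAt c β := by
  cases α using WithZero.recZeroCoe with
  | zero => simp [layerAt_zero]
  | coe α =>
    cases β using WithZero.recZeroCoe with
    | zero => simp [layerAt_zero]
    | coe β =>
      rw [← WithZero.coe_add]
      obtain ⟨a, k⟩ := α
      obtain ⟨b, l⟩ := β
      simp only [val_coe, WithBot.coe_le_coe] at hα hβ
      simp only [layerAt, ELT.add_def, val_coe, s_coe, WithBot.coe_inj]
      rcases lt_trichotomy a b with h | h | h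
      · simp [h, h.not_gt, (h.trans_le hβ).ne]
      · subst h
        simp only [lt_irrefl, if_false]
        split_ifs <;> simp
      · simp [h, (h.trans_le hα).ne]

theorem layerAt_sum {ι : Type*} {S : Finset ι} {α : ι → ELTBar F L} {c : F}
    (h : ∀ i ∈ S, val (α i) ≤ c) : layerAt c (∑ i ∈ S, α i) = ∑ i ∈ S, layerAt c (α i) := by
  classical
  induction S using Finset.induction_on with
  | empty => exact layerAt_zero c
  | insert i S hi ih =>
    have hS : ∀ j ∈ S, val (α j) ≤ c := fun j hj => h j (Finset.mem_insert_of_mem hj)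
    rw [Finset.sum_insert hi, Finset.sum_insert hi,
      layerAt_add (h i (Finset.mem_insert_self _ _)) (val_sum_le hS), ih hS]

/-- A product attains the sum of the bounds only if both factors attain theirs. -/
theorem layerAt_mul {a b : F} {α β : ELTBar F L} (hα : val α ≤ a) (hβ : val β ≤ b) :
    layerAt (a + b) (α * β) = layerAt a α * layerAt b β := by
  cases α using WithZero.recZeroCoe with
  | zero => simp [layerAt_zero]
  | coe α =>
    cases β using WithZero.recZeroCoe with
    | zero => simp [layerAt_zero]
    | coe β =>
      rw [← WithZero.coe_mul]
      obtain ⟨a', k⟩ := α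
      obtain ⟨b', l⟩ := β
      simp only [val_coe, WithBot.coe_le_coe] at hα hβ
      simp only [layerAt, ELT.mul_def, val_coe, s_coe, WithBot.coe_inj]
      simp only [add_eq_add_iff_eq_and_eq hα hβ]
      by_cases h₁ : a' = a <;> by_cases h₂ : b' = b <;> simp [h₁, h₂]

theorem layerAt_prod {ι : Type*} {S : Finset ι} {α : ι → ELTBar F L} {c : ι → F}
    (h : ∀ i ∈ S, val (α i) ≤ c i) :
    layerAt (∑ i ∈ S, c i) (∏ i ∈ S, α i) = ∏ i ∈ S, layerAt (c i) (α i) := by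
  classical
  induction S using Finset.induction_on with
  | empty => exact (layerAt_of_val_eq val_one).trans s_one
  | insert i S hi ih =>
    have hS : ∀ j ∈ S, val (α j) ≤ c j := fun j hj => h j (Finset.mem_insert_of_mem hj)
    have hle : val (∏ j ∈ S, α j) ≤ ((∑ j ∈ S, c j : F) : WithBot F) := by
      rw [val_prod, WithBot.coe_sum]
      exact Finset.sum_le_sum hS
    rw [Finset.sum_insert hi, Finset.prod_insert hi, Finset.prod_insert hi,
      layerAt_mul (h i (Finset.mem_insert_self _ _)) hle, ih hS]

end Value

/-! ### Determinants and their layers -/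

section Determinant

variable {F L : Type*} [AddCommGroup F] [LinearOrder F] [IsOrderedAddMonoid F] [CommRing L]
  {n : ℕ}

theorem map_detWith {R S : Type*} [CommSemiring R] [CommSemiring S] (f : R →+* S) (e : R)
    (A : Matrix (Fin n) (Fin n) R) : f (detWith e A) = detWith (f e) (A.map f) := by
  simp [detWith, map_sum, map_prod]

theorem detWith_neg_one (M : Matrix (Fin n) (Fin n) L) : detWith (-1) M = M.det := by
  rw [← Matrix.det_transpose, Matrix.det_apply, detWith, Finset.mul_sum, Finset.sum_filter,
    Finset.sum_filter, ← Finset.sum_add_distrib]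
  refine Finset.sum_congr rfl fun σ _ => ?_
  rcases Int.units_eq_one_or (Equiv.Perm.sign σ) with h | h <;> simp [h]

theorem val_prod_le_val_detWith (B : Matrix (Fin n) (Fin n) (ELTBar F L))
    (σ : Equiv.Perm (Fin n)) :
    val (∏ i, B i (σ i)) ≤ val (detWith (negOne F L) B) := by
  rw [detWith, val_add, val_mul, val_negOne, zero_add]
  rcases Int.units_eq_one_or (Equiv.Perm.sign σ) with h | h
  · exact le_max_of_le_left
      (val_le_val_sum (fun σ : Equiv.Perm (Fin n) => ∏ i, B i (σ i)) (by simp [h]))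
  · exact le_max_of_le_right
      (val_le_val_sum (fun σ : Equiv.Perm (Fin n) => ∏ i, B i (σ i)) (by simp [h]))

theorem val_detWith_le {B : Matrix (Fin n) (Fin n) (ELTBar F L)} {c : WithBot F}
    (h : ∀ σ : Equiv.Perm (Fin n), val (∏ i, B i (σ i)) ≤ c) :
    val (detWith (negOne F L) B) ≤ c := by
  rw [detWith, val_add, val_mul, val_negOne, zero_add]
  exact max_le (val_sum_le fun σ _ => h σ) (val_sum_le fun σ _ => h σ)

/-- After scaling rows and columns, the leading layer of the determinant is the determinant of the
leading layers. -/
theorem layerAt_detWith {B : Matrix (Fin n) (Fin n) (ELTBar F L)} {u w : Fin n → F}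
    (h : ∀ i j, val (B i j) ≤ ((u i + w j : F) : WithBot F)) :
    layerAt (∑ i, u i + ∑ i, w i) (detWith (negOne F L) B) =
      (Matrix.of fun i j => layerAt (u i + w j) (B i j)).det := by
  -- The bound on a permutation product does not depend on `σ`, so all products are compared at one
  -- tangible value.
  have hsum : ∀ σ : Equiv.Perm (Fin n), ∑ i, u i + ∑ i, w i = ∑ i, (u i + w (σ i)) := by
    intro σ
    rw [Finset.sum_add_distrib, Equiv.sum_comp σ w]
  have hval : ∀ σ : Equiv.Perm (Fin n),
      val (∏ i, B i (σ i)) ≤ ((∑ i, u i + ∑ i, w i : F) : WithBot F) := by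
    intro σ
    rw [hsum σ, val_prod, WithBot.coe_sum]
    exact Finset.sum_le_sum fun i _ => h i (σ i)
  have hprod : ∀ σ : Equiv.Perm (Fin n),
      layerAt (∑ i, u i + ∑ i, w i) (∏ i, B i (σ i)) =
        ∏ i, layerAt (u i + w (σ i)) (B i (σ i)) := by
    intro σ
    rw [hsum σ, layerAt_prod fun i _ => h i (σ i)]
  have hneg : ∀ {c : F} {α : ELTBar F L}, val α ≤ c →
      layerAt c (negOne F L * α) = -1 * layerAt c α := by
    intro c α hα
    have := layerAt_mul (a := 0) (val_negOne (F := F) (L := L)).le hα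
    rw [zero_add] at this
    rw [this, layerAt_of_val_eq val_negOne, s_negOne]
  have hodd : val (∑ σ : Equiv.Perm (Fin n) with Equiv.Perm.sign σ = -1, ∏ i, B i (σ i)) ≤
      ((∑ i, u i + ∑ i, w i : F) : WithBot F) := val_sum_le fun σ _ => hval σ
  rw [← detWith_neg_one, detWith, detWith,
    layerAt_add (val_sum_le fun σ _ => hval σ)
      (by rw [val_mul, val_negOne, zero_add]; exact hodd),
    hneg hodd, layerAt_sum fun σ _ => hval σ, layerAt_sum fun σ _ => hval σ]
  simp only [hprod, Matrix.of_apply]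

/-- A matrix whose product with some nonzero vector of elements of nonzero layer (or `-∞`) has
all layers zero has a determinant of layer zero. -/
theorem s_detWith_eq_zero [IsDomain L] (B : Matrix (Fin n) (Fin n) (ELTBar F L))
    (v : Fin n → ELTBar F L) (hv : ∀ i, v i = 0 ∨ s (v i) ≠ 0) (hv₀ : v ≠ 0)
    (hBv : ∀ i, s (B.mulVec v i) = 0) : s (detWith (negOne F L) B) = 0 := by
  obtain ⟨τ, hτ⟩ := Finite.exists_max fun σ : Equiv.Perm (Fin n) => ∑ i, val (B i (σ i))
  by_cases hfin : ∃ i, val (B i (τ i)) = ⊥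
  · obtain ⟨i, hi⟩ := hfin
    have hbot : ∑ i, val (B i (τ i)) = ⊥ := by
      rw [← Finset.add_sum_erase _ _ (Finset.mem_univ i), hi, WithBot.bot_add]
    have hdet : val (detWith (negOne F L) B) ≤ ⊥ := val_detWith_le fun σ => by
      rw [val_prod, ← hbot]
      exact hτ σ
    rw [val_eq_bot_iff.1 (le_bot_iff.1 hdet), s_zero]
  push Not at hfin
  obtain ⟨u, w, hle, htight⟩ :=
    exists_dual_of_optimal_assignment (fun i j => val (B i j)) τ hfin hτ
  have hval : val (detWith (negOne F L) B) = ((∑ i, u i + ∑ i, w i : F) : WithBot F) := by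
    have hτsum : val (∏ i, B i (τ i)) = ((∑ i, u i + ∑ i, w i : F) : WithBot F) := by
      rw [← Equiv.sum_comp τ w, ← Finset.sum_add_distrib, WithBot.coe_sum, val_prod]
      exact Finset.sum_congr rfl fun i _ => htight i
    refine le_antisymm (val_detWith_le fun σ => ?_) ?_
    · rw [← hτsum, val_prod, val_prod]
      exact hτ σ
    · rw [← hτsum]
      exact val_prod_le_val_detWith B τ
  rw [← layerAt_of_val_eq hval, layerAt_detWith hle]
  obtain ⟨k, hk⟩ := Function.ne_iff.1 hv₀
  have : Nonempty (Fin n) := ⟨k⟩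
  -- With `c` the maximum attained at `m`, each `v j` has value at most `c - w j`, with equality at
  -- `m`. This keeps the truncated vector nonzero.
  obtain ⟨m, hm⟩ := Finite.exists_max fun j => (w j : WithBot F) + val (v j)
  have hvm : val (v m) ≠ ⊥ := by
    intro h
    have := hm k
    rw [h, WithBot.add_bot, le_bot_iff, WithBot.add_eq_bot] at this
    exact this.elim (WithBot.coe_ne_bot) fun h => hk (val_eq_bot_iff.1 h)
  obtain ⟨a, ha⟩ := WithBot.ne_bot_iff_exists.1 hvm
  have hvle : ∀ j, val (v j) ≤ ((-w j + (w m + a) : F) : WithBot F) := by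
    intro j
    have := hm j
    rw [← ha] at this
    cases hj : val (v j) with
    | bot => exact bot_le
    | coe c =>
      rw [hj] at this
      norm_cast at this ⊢
      exact le_neg_add_iff_add_le.2 this
  refine Matrix.exists_mulVec_eq_zero_iff.1
    ⟨fun j => layerAt (-w j + (w m + a)) (v j), fun h => ?_, funext fun i => ?_⟩
  · have h' := congrFun h m
    rw [neg_add_cancel_left, layerAt_of_val_eq ha.symm] at h'
    refine ((hv m).resolve_left fun h₀ => hvm (val_eq_bot_iff.2 h₀)) h'
  · have hc : ∀ j, u i + w j + (-w j + (w m + a)) = u i + (w m + a) := fun j => by abel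
    have hterm : ∀ j ∈ Finset.univ, val (B i j * v j) ≤ ((u i + (w m + a) : F) : WithBot F) := by
      intro j _
      rw [val_mul, ← hc j, WithBot.coe_add]
      exact add_le_add (hle i j) (hvle j)
    -- Row `i` of the product over `L` is the layer of `(B v) i` at value `u i + c`, which vanishes.
    have hrow := layerAt_of_s_eq_zero (c := u i + (w m + a)) (hBv i)
    rw [Matrix.mulVec, dotProduct, layerAt_sum hterm] at hrow
    rw [Matrix.mulVec, dotProduct, Pi.zero_apply, ← hrow]
    refine Finset.sum_congr rfl fun j _ => ?_
    rw [Matrix.of_apply, ← layerAt_mul (hle i j) (hvle j), hc]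

theorem eval_charpoly (A : Matrix (Fin n) (Fin n) (ELTBar F L)) (x : ELTBar F L) :
    (charpoly A).eval x =
      detWith (negOne F L) (x • (1 : Matrix (Fin n) (Fin n) (ELTBar F L)) + negOne F L • A) := by
  rw [charpoly, ← Polynomial.coe_evalRingHom, map_detWith]
  congr 1
  · simp
  · ext1 i j
    by_cases h : i = j <;> simp [Matrix.one_apply, h]

end Determinant

end ELTBar

theorem mainTheorem9 {F L : Type*} [AddCommGroup F] [LinearOrder F] [IsOrderedAddMonoid F]
    [CommRing L] [IsDomain L] {n : ℕ} (A : Matrix (Fin n) (Fin n) (ELTBar F L))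
    (x : ELTBar F L) (hx : ELTBar.IsEigenvalue A x) :
    ELTBar.s ((ELTBar.charpoly A).eval x) = 0 := by
  obtain ⟨v, hv, hv₀, hAv⟩ := hx
  rw [ELTBar.eval_charpoly]
  refine ELTBar.s_detWith_eq_zero _ v hv hv₀ fun i => ?_
  have h : (x • (1 : Matrix (Fin n) (Fin n) (ELTBar F L)) + ELTBar.negOne F L • A).mulVec v =
      (1 + ELTBar.negOne F L) • x • v := by
    rw [Matrix.add_mulVec, Matrix.smul_mulVec, Matrix.smul_mulVec, Matrix.one_mulVec, hAv,
      add_smul, one_smul]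
  rw [h, Pi.smul_apply, smul_eq_mul, ELTBar.s_mul, ELTBar.s_one_add_negOne, zero_mul]
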